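/- \textbf{Setting.} A hybrid system $H=(Q,E,D,F,G,R)$ consists of a finite set $Q$ of modes, a set $E\subset Q\times Q$ of edges, domains $D_q\subseteq\mathbb{R}^n$, vector fields $f_q:D_q\to\mathbb{R}^n$ ($q\in Q$), and, for each edge $e=(q,q')\in E$, a guard set $G_e\subseteq D_q$ and a reset map $\phi_e:G_e\to D_{q'}$. We assume that every $D_q$ is closed and that all $f_q$ and $\phi_e$ are continuous (as is the case for polynomial $f_q$, $\phi_e$ and domains given by finitely many polynomial inequalities $g\ge 0$). $H$ is \emph{cyclic} if every mode is the source of exactly one edge and the target of exactly one edge and the directed graph $(Q,E)$ is connected. A \emph{Zeno equilibrium} is a family $z=\{z_q\}_{q\in Q}$, $z_q\in D_q$, with $f_q(z_q)\ne0$ for all $q$, and $z_q\in G_e$, $\phi_e(z_q)=z_{q'}$ for all $e=(q,q')\in E$. An \emph{execution} of $H$ from $(q_0,x_0)$ consists of a nonempty initial segment $I$ of $\mathbb{N}=\{0,1,\dots\}$ (finite or all of $\mathbb{N}$), times $0=\tau_0\le\tau_1\le\cdots$ indexed by $I$ (with, if $I$ is finite, an end time in $[\tau_{\max I},\infty]$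 of the last interval, this end time not being attained unless the last interval is a single point), modes $p(i)\in Q$ and functions $c_i$ such that $p(0)=q_0$, $c_0(0)=x_0$; for each $i\in I$, $c_i$ is a continuous map into $D_{p(i)}$ on the $i$-th time interval with $\dot c_i=f_{p(i)}(c_i)$ in its interior; and whenever $i+1\in I$, the $i$-th interval is $[\tau_i,\tau_{i+1}]$, $(p(i),p(i+1))\in E$, $c_i(\tau_{i+1})\in G_{(p(i),p(i+1))}$ and $c_{i+1}(\tau_{i+1})=\phi_{(p(i),p(i+1))}(c_i(\tau_{i+1}))$. It is \emph{maximal} if it is not a proper prefix of another execution. It is \emph{Zeno} if $I=\mathbb{N}$ and $\lim_i\tau_i<\infty$. The Zeno equilibrium $z$ is \emph{Zeno stable} if there are sets $Z_q\subseteq D_q$, each a neighborhood of $z_q$ relative to $D_q$, such that from every $(q_0,x_0)$ with $x_0\in Z_{q_0}$ there is a maximal execution, and every maximal execution from $(q_0,x_0)$ is Zeno and satisfies: for every $\epsilon>0$ there is $N$ with $\|c_i(\tau_{i+1})-z_{p(i)}\|\le\epsilon$ for all $i>N$. $H$ \emph{does not block} at $(q,x)$ if either $x\in G_e$ for an edge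 $e\in E$ with source $q$, or for some $\varepsilon>0$ there is a continuous $c:[0,\varepsilon)\to\mathbb{R}^n$ with $c(0)=x$ and with $c(t)\in D_q$ and $\dot c(t)=f_q(c(t))$ for $0<t<\varepsilon$. \textbf{Theorem.} Let $H$ be a cyclic hybrid system as above with Zeno equilibrium $z$, and for each $q\in Q$ let $W_q\subseteq D_q$ be a neighborhood of $z_q$ relative to $D_q$ such that $H$ does not block at $(q,x)$ for any $x\in W_q$. Suppose that there are continuously differentiable functions $V_q:W_q\to\mathbb{R}$ (that is, $V_q$ is differentiable relative to $W_q$ with a gradient $\nabla V_q$ that is continuous on $W_q$), constants $r_q\in(0,1]$ for $q\in Q$ with $r_q<1$ for at least one $q$, and $\gamma>0$ such that \begin{align*} V_q(x)&>0 && \text{for all } x\in W_q\setminus\{z_q\},\ q\in Q,\\ V_q(z_q)&=0 && \text{for all } q\in Q,\\ \nabla V_q(x)^T f_q(x)&\le-\gamma && \text{for all } x\in W_q,\ q\in Q,\\ V_{q'}(\phi_e(x))&\le r_qV_q(x) && \text{for all } e=(q,q')\in E \text{ and } x\in G_e\cap W_q \text{ with } \phi_e(x)\in W_{q'}. \end{align*}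 Then $z$ is Zeno stable. -/

import Mathlib

open Set Filter Topology

/-- A hybrid system with set of modes `Q` and continuous state space `ℝⁿ`. The maps `f q` and `φ e`
are total functions; only their values on `D q` and on `G e` are ever used. -/
structure HybridSystem (Q : Type*) (n : ℕ) where
  /-- edges -/
  E : Set (Q × Q)
  /-- domains -/
  D : Q → Set (EuclideanSpace ℝ (Fin n))
  /-- vector fields -/
  f : Q → EuclideanSpace ℝ (Fin n) → EuclideanSpace ℝ (Fin n)
  /-- guard sets -/
  G : Q × Q → Set (EuclideanSpace ℝ (Fin n))
  /-- reset maps -/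
  φ : Q × Q → EuclideanSpace ℝ (Fin n) → EuclideanSpace ℝ (Fin n)
  guard_subset : ∀ q q', (q, q') ∈ E → G (q, q') ⊆ D q
  reset_mapsTo : ∀ q q', (q, q') ∈ E → MapsTo (φ (q, q')) (G (q, q')) (D q')

/-- The time structure of an execution: an initial segment `I` of `ℕ` (finite or all of `ℕ`) that
indexes the intervals of continuous evolution, their starting times `τ i`, `i ∈ I`, and, when `I`
is finite, the end `tEnd ∈ (-∞, ∞]` of the last interval. Intervals may have length zero. -/
structure HybridTime where
  I : Set ℕ
  zero_mem : 0 ∈ I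
  pred_mem : ∀ i, i + 1 ∈ I → i ∈ I
  τ : ℕ → ℝ
  τ_zero : τ 0 = 0
  tEnd : EReal
  τ_le : ∀ i, i + 1 ∈ I → τ i ≤ τ (i + 1)
  τ_le_tEnd : ∀ i ∈ I, i + 1 ∉ I → (τ i : EReal) ≤ tEnd

namespace HybridTime

/-- The open time interval `(τ i, τ (i + 1))`, or `(τ i, tEnd)` if `i` is the last index. -/
def T (θ : HybridTime) (i : ℕ) : Set ℝ :=
  {t | θ.τ i < t ∧ (i + 1 ∈ θ.I → t < θ.τ (i + 1)) ∧ (i + 1 ∉ θ.I → (t : EReal) < θ.tEnd)}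

/-- The times at which the `i`-th piece is defined: the open interval with its left end, and with
its right end if a transition takes place there. -/
def dom (θ : HybridTime) (i : ℕ) : Set ℝ :=
  {t | t = θ.τ i ∨ t ∈ θ.T i ∨ (i + 1 ∈ θ.I ∧ t = θ.τ (i + 1))}

end HybridTime

namespace HybridSystem

variable {Q : Type*} {n : ℕ}

/-- Each mode is the source of exactly one edge and the target of exactly one edge, and the
directed graph of modes and edges is connected. -/
structure IsCyclic (H : HybridSystem Q n) : Prop where
  out : ∀ q, ∃! e, e ∈ H.E ∧ e.1 = q
  into : ∀ q, ∃! e, e ∈ H.E ∧ e.2 = q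
  connected : ∀ q q', Relation.EqvGen (fun a b => (a, b) ∈ H.E) q q'

/-- A Zeno equilibrium. -/
structure IsZenoEquilibrium (H : HybridSystem Q n) (z : Q → EuclideanSpace ℝ (Fin n)) : Prop where
  mem_domain : ∀ q, z q ∈ H.D q
  mem_guard : ∀ q q', (q, q') ∈ H.E → z q ∈ H.G (q, q')
  reset_eq : ∀ q q', (q, q') ∈ H.E → H.φ (q, q') (z q) = z q'
  field_ne_zero : ∀ q, H.f q (z q) ≠ 0

/-- Executions, finite or infinite. The piece `c i` is continuous on the interval `dom i` and solves
the differential equation on its interior `T i` (where it is then continuously differentiable if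
`H.f (p i)` is continuous on `H.D (p i)`). Values of `τ`, `p`, `c` outside of `I` and of the
intervals have no meaning. -/
structure Execution (H : HybridSystem Q n) extends HybridTime where
  p : ℕ → Q
  c : ℕ → ℝ → EuclideanSpace ℝ (Fin n)
  continuousOn : ∀ i ∈ I, ContinuousOn (c i) (toHybridTime.dom i)
  hasDerivAt : ∀ i ∈ I, ∀ t ∈ toHybridTime.T i, HasDerivAt (c i) (H.f (p i) (c i t)) t
  mem_domain : ∀ i ∈ I, ∀ t ∈ toHybridTime.dom i, c i t ∈ H.D (p i)
  edge_mem : ∀ i, i + 1 ∈ I → (p i, p (i + 1)) ∈ H.E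
  mem_guard : ∀ i, i + 1 ∈ I → c i (τ (i + 1)) ∈ H.G (p i, p (i + 1))
  reset_eq : ∀ i, i + 1 ∈ I → c (i + 1) (τ (i + 1)) = H.φ (p i, p (i + 1)) (c i (τ (i + 1)))

namespace Execution

variable {H : HybridSystem Q n}

/-- The execution starts from `(q₀, x₀)` at time `0`. -/
def StartsAt (χ : Execution H) (q₀ : Q) (x₀ : EuclideanSpace ℝ (Fin n)) : Prop :=
  χ.p 0 = q₀ ∧ χ.c 0 0 = x₀

/-- `χ'` extends `χ`, that is, `χ` is a prefix of `χ'`. -/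
def Extends (χ' χ : Execution H) : Prop :=
  χ.I ⊆ χ'.I ∧ ∀ i ∈ χ.I, χ'.τ i = χ.τ i ∧ χ'.p i = χ.p i ∧
    χ.dom i ⊆ χ'.dom i ∧ EqOn (χ'.c i) (χ.c i) (χ.dom i)

/-- `χ` has no proper extension. -/
def IsMaximal (χ : Execution H) : Prop :=
  ∀ χ' : Execution H, χ'.Extends χ → χ.Extends χ'

/-- Infinitely many transitions in finite time. -/
def IsZeno (χ : Execution H) : Prop :=
  χ.I = univ ∧ ∃ L : ℝ, Tendsto χ.τ atTop (𝓝 L)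

end Execution

/-- The system does not block at the state `(q, x)`: either the flow of `f q` can be followed from
`x` inside `D q` for some positive time, or `x` lies in the guard set of an edge leaving `q`. -/
def NonblockingAt (H : HybridSystem Q n) (q : Q) (x : EuclideanSpace ℝ (Fin n)) : Prop :=
  (∃ ε : ℝ, 0 < ε ∧ ∃ c : ℝ → EuclideanSpace ℝ (Fin n), c 0 = x ∧ ContinuousOn c (Ico 0 ε) ∧
    ∀ t ∈ Ioo 0 ε, c t ∈ H.D q ∧ HasDerivAt c (H.f q (c t)) t) ∨
  ∃ q', (q, q') ∈ H.E ∧ x ∈ H.G (q, q')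

/-- Zeno stability of `z`: for some neighborhoods `Z q` of `z q` in `D q`, from each initial
condition in `Z q₀` there is a maximal execution, and each such execution is Zeno and its states
at the ends of the intervals of continuous evolution converge to `z`. -/
def IsZenoStable (H : HybridSystem Q n) (z : Q → EuclideanSpace ℝ (Fin n)) : Prop :=
  ∃ Z : Q → Set (EuclideanSpace ℝ (Fin n)),
    (∀ q, Z q ⊆ H.D q ∧ Z q ∈ 𝓝[H.D q] (z q)) ∧
    ∀ q₀, ∀ x₀ ∈ Z q₀,
      (∃ χ : Execution H, χ.StartsAt q₀ x₀ ∧ χ.IsMaximal) ∧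
      ∀ χ : Execution H, χ.StartsAt q₀ x₀ → χ.IsMaximal →
        χ.IsZeno ∧ ∀ ε > 0, ∃ N : ℕ, ∀ i > N, ‖χ.c i (χ.τ (i + 1)) - z (χ.p i)‖ ≤ ε

end HybridSystem

/-! Each `V q` falls at rate at least `γ` along the flow and does not grow at transitions. An
execution confined to the region where these estimates apply therefore lasts at most `V q₀ x₀ / γ`
in total. It remains to confine executions, to exclude that they stop, and to prove convergence.

Confinement: take `R q` such that the points of `D q` within distance `R q` of `z q` lie in `W q`,
and `ρ q ≤ R q` such that the reset sends guard points closer than `ρ q` to `z q` into the next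
`R`-ball. By compactness all `V q` are at least some `a > 0` on the shells between radii `ρ q` and
`R q`. The set `S q` of points of `D q` with distance less than `R q` and `V q x < a` then lies in
the `ρ q`-ball. The flow cannot leave it without meeting the shell, and transitions map `S q` into
`S q'`. `IsDecayRegion` records these properties.

No stopping (`I_eq_univ`): a last piece of infinite length would make `V` negative. If the last
piece ends at a finite time, boundedness of the field gives a limit state, which is again in `S q`;
the system does not block there, so the execution can be prolonged. Maximal executions exist by
Zorn's lemma.

Convergence: the values of `V` decrease to some `L ≥ 0`. A mode with `r q < 1` recurs infinitely
often on the cycle, so `L ≤ r q * L` and `L = 0`. The shell bound with inner radius `ε` turns this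
into convergence of states. -/

/-! ### Calculus along solutions: decay, limits at the end, concatenation -/

/-- If the derivative of `V` along `f` is at most `-γ` on `W`, then `V` decreases at rate at least `γ`
along solutions in `W`. -/
theorem lyapunov_decay {E : Type*} [NormedAddCommGroup E] [InnerProductSpace ℝ E] [CompleteSpace E]
    {V : E → ℝ} {gradV f : E → E} {W : Set E} {γ a b : ℝ} {c : ℝ → E}
    (hV : ∀ x ∈ W, HasGradientWithinAt V (gradV x) W x)
    (hdecr : ∀ x ∈ W, inner ℝ (gradV x) (f x) ≤ -γ)
    (hab : a ≤ b) (hc : ContinuousOn c (Icc a b)) (hW : ∀ t ∈ Icc a b, c t ∈ W)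
    (hder : ∀ t ∈ Ioo a b, HasDerivAt c (f (c t)) t) :
    V (c b) ≤ V (c a) - γ * (b - a) := by
  have hcont : ContinuousOn (V ∘ c) (Icc a b) :=
    ContinuousOn.comp (fun x hx => (hV x hx).continuousWithinAt) hc hW
  have hd : ∀ t ∈ Ioo a b, HasDerivAt (V ∘ c) (inner ℝ (gradV (c t)) (f (c t))) t := by
    intro t ht
    -- A derivative relative to `W` suffices for the chain rule, because `c` stays in `W` near `t`.
    have := (hV (c t) (hW t (Ioo_subset_Icc_self ht))).hasFDerivWithinAt.comp_hasDerivAt t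
      (hder t ht) (by
        filter_upwards [isOpen_Ioo.mem_nhds ht] with s hs using hW s (Ioo_subset_Icc_self hs))
    simpa using this
  have := Convex.image_sub_le_mul_sub_of_deriv_le (convex_Icc a b) hcont (C := -γ)
    (by
      rw [interior_Icc]
      exact fun t ht => (hd t ht).differentiableAt.differentiableWithinAt)
    (by
      rw [interior_Icc]
      intro t ht
      rw [(hd t ht).deriv]
      exact hdecr _ (hW t (Ioo_subset_Icc_self ht)))
    a (left_mem_Icc.2 hab) b (right_mem_Icc.2 hab) hab
  simp only [Function.comp] at this
  linarith

/-- A curve with bounded derivative on `(a, b)` that is continuous at `a` extends continuously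
to `[a, b]`. -/
theorem exists_continuousOn_Icc_of_bounded_deriv {E : Type*} [NormedAddCommGroup E]
    [NormedSpace ℝ E] [CompleteSpace E] {a b C : ℝ} {c c' : ℝ → E} (hab : a ≤ b)
    (hc : ContinuousOn c (insert a (Ioo a b)))
    (hder : ∀ t ∈ Ioo a b, HasDerivAt c (c' t) t) (hbd : ∀ t ∈ Ioo a b, ‖c' t‖ ≤ C) :
    ∃ g : ℝ → E, ContinuousOn g (Icc a b) ∧ EqOn g c (insert a (Ioo a b)) := by
  rcases hab.eq_or_lt with rfl | hab
  · exact ⟨c, by simp, fun _ _ => rfl⟩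
  -- A bounded derivative makes `c` Lipschitz, hence uniformly continuous, so its values form a
  -- Cauchy filter at `b`; the limit becomes the value at `b`.
  have hlip : LipschitzOnWith (Real.toNNReal C) c (Ioo a b) := by
    refine (convex_Ioo a b).lipschitzOnWith_of_nnnorm_hasDerivWithin_le
      (fun t ht => (hder t ht).hasDerivWithinAt) fun t ht => ?_
    exact NNReal.le_toNNReal_of_coe_le (hbd t ht)
  have hne : (𝓝[Ioo a b] b).NeBot := by
    rw [nhdsWithin_Ioo_eq_nhdsLT hab]; infer_instance
  have hcau : Cauchy (map c (𝓝[Ioo a b] b)) := by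
    refine ⟨hne.map c, ?_⟩
    have h2 := hlip.uniformContinuousOn
    rw [UniformContinuousOn] at h2
    rw [prod_map_map_eq]
    refine h2.mono_left (le_inf ?_ ?_)
    · exact (Filter.prod_mono nhdsWithin_le_nhds nhdsWithin_le_nhds).trans
        (by rw [← nhds_prod_eq]; exact nhds_le_uniformity b)
    · rw [le_principal_iff]
      exact prod_mem_prod self_mem_nhdsWithin self_mem_nhdsWithin
  obtain ⟨x, hx⟩ := CompleteSpace.complete hcau
  have hIco : insert a (Ioo a b) = Ico a b := Ioo_insert_left hab
  rw [hIco] at hc ⊢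
  have heq : EqOn (Function.update c b x) c (Ico a b) := fun t ht =>
    Function.update_of_ne ht.2.ne _ _
  refine ⟨Function.update c b x, fun t ht => ?_, heq⟩
  rcases ht.2.eq_or_lt with rfl | htb
  · rw [continuousWithinAt_update_same]
    refine Tendsto.mono_left (show Tendsto c _ _ from hx) ?_
    rw [Icc_sdiff_right, nhdsWithin_Ico_eq_nhdsLT hab, nhdsWithin_Ioo_eq_nhdsLT hab]
  · have h1 : ContinuousWithinAt (Function.update c b x) (Ico a b) t :=
      (hc t ⟨ht.1, htb⟩).congr heq (heq ⟨ht.1, htb⟩)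
    refine h1.mono_of_mem_nhdsWithin ?_
    rw [← Ici_inter_Iio]
    exact inter_mem (mem_of_superset self_mem_nhdsWithin fun s hs => hs.1)
      (mem_nhdsWithin_of_mem_nhds (Iio_mem_nhds htb))

/-- A continuous function whose derivative near `b`, apart from `b`, tends to `e` at `b` has
derivative `e` at `b`. -/
theorem hasDerivAt_of_tendsto_punctured {E : Type*} [NormedAddCommGroup E] [NormedSpace ℝ E]
    {g g' : ℝ → E} {b : ℝ} {e : E} (hg : ContinuousAt g b)
    (hder : ∀ᶠ t in 𝓝[≠] b, HasDerivAt g (g' t) t) (hlim : Tendsto g' (𝓝[≠] b) (𝓝 e)) :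
    HasDerivAt g e b := by
  have hlim' : Tendsto (fun t => deriv g t) (𝓝[≠] b) (𝓝 e) :=
    hlim.congr' (hder.mono fun t ht => ht.deriv.symm)
  have hdiff : DifferentiableOn ℝ g {t | HasDerivAt g (g' t) t} :=
    fun t ht => (HasDerivAt.differentiableAt ht).differentiableWithinAt
  have hR : (𝓝[>] b) ≤ 𝓝[≠] b := nhdsWithin_mono _ fun t ht => ne_of_gt ht
  have hL : (𝓝[<] b) ≤ 𝓝[≠] b := nhdsWithin_mono _ fun t ht => ne_of_lt ht
  have h1 := hasDerivWithinAt_Ici_of_tendsto_deriv hdiff hg.continuousWithinAt (hR hder)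
    (hlim'.mono_left hR)
  have h2 := hasDerivWithinAt_Iic_of_tendsto_deriv hdiff hg.continuousWithinAt (hL hder)
    (hlim'.mono_left hL)
  simpa using h2.union h1

/-- Two solutions of an autonomous differential equation with continuous right-hand side can be
concatenated. -/
theorem exists_concat_solution {E : Type*} [NormedAddCommGroup E] [NormedSpace ℝ E]
    {D : Set E} {f : E → E} (hf : ContinuousOn f D) {a b ε : ℝ} (hab : a ≤ b) (hε : 0 < ε)
    {c d : ℝ → E} (hc : ContinuousOn c (Icc a b)) (hcD : ∀ t ∈ Icc a b, c t ∈ D)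
    (hcder : ∀ t ∈ Ioo a b, HasDerivAt c (f (c t)) t)
    (hd : ContinuousOn d (Ico 0 ε)) (hdD : ∀ t ∈ Ioo 0 ε, d t ∈ D)
    (hdder : ∀ t ∈ Ioo 0 ε, HasDerivAt d (f (d t)) t) (hcd : d 0 = c b) :
    ∃ g : ℝ → E, EqOn g c (Iic b) ∧ ContinuousOn g (Ico a (b + ε)) ∧
      (∀ t ∈ Ico a (b + ε), g t ∈ D) ∧ ∀ t ∈ Ioo a (b + ε), HasDerivAt g (f (g t)) t := by
  set g : ℝ → E := fun t => if t ≤ b then c t else d (t - b) with hgdef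
  have hgl : EqOn g c (Iic b) := fun t ht => if_pos ht
  have hgr : EqOn g (fun t => d (t - b)) (Ici b) := by
    intro t ht
    rcases (mem_Ici.1 ht).eq_or_lt with rfl | h
    · simp [hgdef, hcd]
    · simp [hgdef, not_le.2 h]
  have hcr : ContinuousOn g (Ico b (b + ε)) := by
    refine ContinuousOn.congr (f := fun t => d (t - b)) ?_ fun t ht => hgr ht.1
    exact hd.comp (by fun_prop) fun t ht => ⟨by linarith [ht.1], by linarith [ht.2]⟩
  have hcl : ContinuousOn g (Icc a b) := hc.congr fun t ht => hgl ht.2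
  have hcont : ContinuousOn g (Ico a (b + ε)) := by
    rw [← Icc_union_Ico_eq_Ico hab (by linarith : b < b + ε)]
    intro t ht
    rcases lt_trichotomy t b with h | rfl | h
    · have hta : a ≤ t := by rcases ht with ht | ht <;> linarith [ht.1]
      refine (hcl t ⟨hta, h.le⟩).union (continuousWithinAt_of_notMem_closure fun h' => ?_)
      have := closure_mono Ico_subset_Icc_self h'
      rw [closure_Icc] at this
      exact absurd this.1 (not_le.2 h)
    · exact (hcl t ⟨hab, le_rfl⟩).union (hcr t ⟨le_rfl, by linarith⟩)
    · have htb : t < b + ε := by rcases ht with ht | ht <;> linarith [ht.2]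
      refine ContinuousWithinAt.union (continuousWithinAt_of_notMem_closure fun h' => ?_)
        (hcr t ⟨h.le, htb⟩)
      rw [closure_Icc] at h'
      exact absurd h'.2 (not_le.2 h)
  have hgD : ∀ t ∈ Ico a (b + ε), g t ∈ D := by
    intro t ht
    rcases le_or_gt t b with h | h
    · rw [hgl h]; exact hcD t ⟨ht.1, h⟩
    · rw [hgr h.le]; exact hdD _ ⟨by linarith, by linarith [ht.2]⟩
  have hlt : ∀ t ∈ Ioo a b, HasDerivAt g (f (g t)) t := fun t ht => by
    rw [hgl ht.2.le]
    exact (hcder t ht).congr_of_eventuallyEq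
      (by filter_upwards [Iio_mem_nhds ht.2] with s hs using hgl (mem_Iio.1 hs).le)
  have hgt : ∀ t ∈ Ioo b (b + ε), HasDerivAt g (f (g t)) t := fun t ht => by
    rw [hgr ht.1.le]
    have h1 : HasDerivAt (fun s => d (s - b)) (f (d (t - b))) t :=
      (hdder (t - b) ⟨by linarith [ht.1], by linarith [ht.2]⟩).comp_sub_const t b
    exact h1.congr_of_eventuallyEq
      (by filter_upwards [Ioi_mem_nhds ht.1] with s hs using hgr (mem_Ioi.1 hs).le)
  refine ⟨g, hgl, hcont, hgD, fun t ht => ?_⟩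
  rcases lt_trichotomy t b with h | rfl | h
  · exact hlt t ⟨ht.1, h⟩
  · have hmem : Ioo a (t + ε) ∈ 𝓝 t := isOpen_Ioo.mem_nhds ht
    -- At the junction the derivatives on both sides have the common limit `f (g t)`, since `f ∘ g`
    -- is continuous there.
    have hfg : ContinuousAt (fun s => f (g s)) t :=
      ((hf.comp hcont hgD).mono Ioo_subset_Ico_self).continuousAt hmem
    refine hasDerivAt_of_tendsto_punctured
      ((hcont.mono Ioo_subset_Ico_self).continuousAt hmem) ?_
      (hfg.tendsto.mono_left nhdsWithin_le_nhds)
    filter_upwards [self_mem_nhdsWithin, mem_nhdsWithin_of_mem_nhds hmem] with s hs hs'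
    rcases lt_or_gt_of_ne hs with h | h
    · exact hlt s ⟨hs'.1, h⟩
    · exact hgt s ⟨h, hs'.2⟩
  · exact hgt t ⟨h, ht.2⟩

/-! ### Time intervals of an execution -/

namespace HybridTime

theorem T_of_succ_mem {θ : HybridTime} {i : ℕ} (h : i + 1 ∈ θ.I) :
    θ.T i = Ioo (θ.τ i) (θ.τ (i + 1)) := by
  ext t; simp [T, h]

theorem dom_of_succ_mem {θ : HybridTime} {i : ℕ} (h : i + 1 ∈ θ.I) :
    θ.dom i = Icc (θ.τ i) (θ.τ (i + 1)) := by
  have hle := θ.τ_le i h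
  ext t
  simp only [dom, T_of_succ_mem h, mem_ofPred_eq, h, true_and, mem_Ioo, mem_Icc]
  constructor
  · rintro (rfl | ⟨h1, h2⟩ | rfl)
    · exact ⟨le_rfl, hle⟩
    · exact ⟨h1.le, h2.le⟩
    · exact ⟨hle, le_rfl⟩
  · rintro ⟨h1, h2⟩
    rcases h1.eq_or_lt with rfl | h1
    · exact Or.inl rfl
    · rcases h2.eq_or_lt with rfl | h2
      · exact Or.inr (Or.inr rfl)
      · exact Or.inr (Or.inl ⟨h1, h2⟩)

theorem T_of_succ_notMem {θ : HybridTime} {i : ℕ} (h : i + 1 ∉ θ.I) :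
    θ.T i = {t | θ.τ i < t ∧ (t : EReal) < θ.tEnd} := by
  ext t; simp [T, h]

theorem T_of_tEnd_eq {θ : HybridTime} {i : ℕ} {b : ℝ} (h : i + 1 ∉ θ.I) (hb : θ.tEnd = b) :
    θ.T i = Ioo (θ.τ i) b := by
  ext t; simp [T, h, hb]

theorem dom_of_succ_notMem {θ : HybridTime} {i : ℕ} (h : i + 1 ∉ θ.I) :
    θ.dom i = insert (θ.τ i) (θ.T i) := by
  ext t; simp [dom, h]

theorem isOpen_T (θ : HybridTime) (i : ℕ) : IsOpen (θ.T i) := by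
  by_cases h : i + 1 ∈ θ.I
  · rw [T_of_succ_mem h]; exact isOpen_Ioo
  · rw [T_of_succ_notMem h]
    exact isOpen_Ioi.inter (isOpen_Iio.preimage continuous_coe_real_ereal)

theorem T_subset_dom (θ : HybridTime) (i : ℕ) : θ.T i ⊆ θ.dom i := fun _ h => Or.inr (Or.inl h)

theorem left_mem_dom (θ : HybridTime) (i : ℕ) : θ.τ i ∈ θ.dom i := Or.inl rfl

theorem right_mem_dom {θ : HybridTime} {i : ℕ} (h : i + 1 ∈ θ.I) : θ.τ (i + 1) ∈ θ.dom i :=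
  Or.inr (Or.inr ⟨h, rfl⟩)

theorem left_le_of_mem_dom {θ : HybridTime} {i : ℕ} {t : ℝ} (ht : t ∈ θ.dom i) : θ.τ i ≤ t := by
  rcases ht with rfl | ht | ⟨h, rfl⟩
  · rfl
  · exact ht.1.le
  · exact θ.τ_le i h

theorem Ioo_subset_T {θ : HybridTime} {i : ℕ} {t : ℝ} (ht : t ∈ θ.dom i) :
    Ioo (θ.τ i) t ⊆ θ.T i := by
  intro s hs
  rcases ht with rfl | ht | ⟨h, rfl⟩
  · exact absurd hs.1 (not_lt.2 hs.2.le)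
  · exact ⟨hs.1, fun h => hs.2.trans (ht.2.1 h),
      fun h => (EReal.coe_lt_coe_iff.2 hs.2).trans (ht.2.2 h)⟩
  · rw [T_of_succ_mem h]; exact hs

theorem Icc_subset_dom {θ : HybridTime} {i : ℕ} {t : ℝ} (ht : t ∈ θ.dom i) :
    Icc (θ.τ i) t ⊆ θ.dom i := by
  intro s hs
  rcases hs.1.eq_or_lt with rfl | h1
  · exact θ.left_mem_dom i
  · rcases hs.2.eq_or_lt with rfl | h2
    · exact ht
    · exact θ.T_subset_dom i (Ioo_subset_T ht ⟨h1, h2⟩)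

theorem mem_of_le (θ : HybridTime) {i j : ℕ} (hij : i ≤ j) (hj : j ∈ θ.I) : i ∈ θ.I := by
  induction j, hij using Nat.le_induction with
  | base => exact hj
  | succ k _ ih => exact ih (θ.pred_mem k hj)

theorem le_of_mem_of_succ_notMem (θ : HybridTime) {i m : ℕ} (hm : m + 1 ∉ θ.I) (hi : i ∈ θ.I) :
    i ≤ m := by
  by_contra h
  exact hm (θ.mem_of_le (by omega) hi)

end HybridTime

/-! ### Prefix order on executions and existence of maximal ones -/

namespace HybridSystem

variable {Q : Type*} {n : ℕ} {H : HybridSystem Q n}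

namespace Execution

theorem Extends.refl (χ : Execution H) : χ.Extends χ :=
  ⟨subset_rfl, fun _ _ => ⟨rfl, rfl, subset_rfl, fun _ _ => rfl⟩⟩

theorem Extends.trans {χ₁ χ₂ χ₃ : Execution H} (h₁ : χ₃.Extends χ₂) (h₂ : χ₂.Extends χ₁) :
    χ₃.Extends χ₁ := by
  refine ⟨h₂.1.trans h₁.1, fun i hi => ?_⟩
  obtain ⟨a, b, c, d⟩ := h₂.2 i hi
  obtain ⟨a', b', c', d'⟩ := h₁.2 i (h₂.1 hi)
  exact ⟨a'.trans a, b'.trans b, c.trans c', fun t ht => (d' (c ht)).trans (d ht)⟩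

theorem StartsAt.of_extends {χ χ' : Execution H} {q₀ : Q} {x₀ : EuclideanSpace ℝ (Fin n)}
    (hs : χ.StartsAt q₀ x₀) (h : χ'.Extends χ) : χ'.StartsAt q₀ x₀ := by
  obtain ⟨_, hp, _, hc⟩ := h.2 0 χ.zero_mem
  refine ⟨hp.trans hs.1, (hc ?_).trans hs.2⟩
  rw [← χ.τ_zero]
  exact χ.left_mem_dom 0

/-- The execution that stays at `x₀` for the single time `0`. -/
noncomputable def point (q₀ : Q) (x₀ : EuclideanSpace ℝ (Fin n)) (h : x₀ ∈ H.D q₀) : Execution H where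
  I := {0}
  zero_mem := rfl
  pred_mem := by simp
  τ := 0
  τ_zero := rfl
  tEnd := 0
  τ_le := by simp
  τ_le_tEnd := by simp
  p := fun _ => q₀
  c := fun _ _ => x₀
  continuousOn := fun _ _ => continuousOn_const
  hasDerivAt := by
    intro i hi t ht
    obtain ⟨h1, -, h2⟩ := ht
    have h3 := h2 (by simp)
    simp only [Pi.zero_apply] at h1
    exact absurd (EReal.coe_lt_coe_iff.1 h3) (not_lt.2 h1.le)
  mem_domain := fun _ _ _ _ => h
  edge_mem := by simp
  mem_guard := by simp
  reset_eq := by simp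

/-- The upper bound for Zorn's lemma is the union of the chain. Members agree wherever both are
defined, so each value can be read off from any member defined there. -/
theorem exists_extends_of_isChain {C : Set (Execution H)}
    (hC : IsChain (fun a b : Execution H => b.Extends a) C) (hne : C.Nonempty) :
    ∃ χ' : Execution H, ∀ χ ∈ C, χ'.Extends χ := by
  classical
  have htot : ∀ a ∈ C, ∀ b ∈ C, b.Extends a ∨ a.Extends b := by
    intro a ha b hb
    rcases eq_or_ne a b with rfl | hab
    · exact Or.inl (Extends.refl a)
    · exact hC ha hb hab
  set I : Set ℕ := {i | ∃ χ ∈ C, i ∈ χ.I} with hI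
  obtain ⟨χ₀, hχ₀⟩ := hne
  have hX : ∀ i, ∃ χ : Execution H, i ∈ I → χ ∈ C ∧ i ∈ χ.I := by
    intro i
    by_cases h : i ∈ I
    · obtain ⟨χ, h⟩ := h; exact ⟨χ, fun _ => h⟩
    · exact ⟨χ₀, fun h' => absurd h' h⟩
  choose X hX using hX
  have hY : ∀ (i : ℕ) (t : ℝ), ∃ χ : Execution H,
      (∃ χ' ∈ C, i ∈ χ'.I ∧ t ∈ χ'.dom i) → χ ∈ C ∧ i ∈ χ.I ∧ t ∈ χ.dom i := by
    intro i t
    by_cases h : ∃ χ' ∈ C, i ∈ χ'.I ∧ t ∈ χ'.dom i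
    · obtain ⟨χ, h⟩ := h; exact ⟨χ, fun _ => h⟩
    · exact ⟨χ₀, fun h' => absurd h' h⟩
  choose Y hY using hY
  have hτ : ∀ χ ∈ C, ∀ i ∈ χ.I, (X i).τ i = χ.τ i ∧ (X i).p i = χ.p i := by
    intro χ hχ i hi
    obtain ⟨h1, h2⟩ := hX i ⟨χ, hχ, hi⟩
    rcases htot _ h1 _ hχ with h | h
    · exact ⟨(h.2 i h2).1.symm, (h.2 i h2).2.1.symm⟩
    · exact ⟨(h.2 i hi).1, (h.2 i hi).2.1⟩
  have hc : ∀ χ ∈ C, ∀ i ∈ χ.I, ∀ t ∈ χ.dom i, (Y i t).c i t = χ.c i t := by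
    intro χ hχ i hi t ht
    obtain ⟨h1, h2, h3⟩ := hY i t ⟨χ, hχ, hi, ht⟩
    rcases htot _ h1 _ hχ with h | h
    · exact ((h.2 i h2).2.2.2 h3).symm
    · exact (h.2 i hi).2.2.2 ht
  let θ : HybridTime :=
    { I := I
      zero_mem := ⟨χ₀, hχ₀, χ₀.zero_mem⟩
      pred_mem := fun i ⟨χ, h, h'⟩ => ⟨χ, h, χ.pred_mem i h'⟩
      τ := fun i => (X i).τ i
      τ_zero := (X 0).τ_zero
      -- Only members that reach the last index of the union count. If there is no last index, the
      -- set is empty and `tEnd` has no meaning.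
      tEnd := sSup {x | ∃ χ ∈ C, ∃ i ∈ χ.I, i + 1 ∉ I ∧ χ.tEnd = x}
      τ_le := by
        rintro i ⟨χ, h, h'⟩
        rw [(hτ χ h _ h').1, (hτ χ h _ (χ.pred_mem i h')).1]
        exact χ.τ_le i h'
      τ_le_tEnd := by
        rintro i ⟨χ, h, h'⟩ hi
        rw [(hτ χ h _ h').1]
        have hi' : i + 1 ∉ χ.I := fun h'' => hi ⟨χ, h, h''⟩
        exact (χ.τ_le_tEnd i h' hi').trans (le_sSup ⟨χ, h, i, h', hi, rfl⟩) }
  have hθI : θ.I = I := rfl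
  have hθτ : ∀ χ ∈ C, ∀ i ∈ χ.I, θ.τ i = χ.τ i := fun χ h i hi => (hτ χ h i hi).1
  have hdomeq : ∀ χ ∈ C, ∀ i, i + 1 ∈ χ.I → θ.dom i = χ.dom i := by
    intro χ h i hi
    have hi' : i + 1 ∈ θ.I := ⟨χ, h, hi⟩
    rw [HybridTime.dom_of_succ_mem hi, HybridTime.dom_of_succ_mem hi', hθτ χ h _ hi,
      hθτ χ h _ (χ.pred_mem i hi)]
  have hdomsub : ∀ χ ∈ C, ∀ i ∈ χ.I, χ.dom i ⊆ θ.dom i := by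
    intro χ h i hi
    by_cases hi' : i + 1 ∈ I
    · obtain ⟨χ', h', hi'⟩ := hi'
      rw [hdomeq χ' h' i hi']
      rcases htot χ h χ' h' with hx | hx
      · exact (hx.2 i hi).2.2.1
      · rw [← hdomeq χ' h' i hi', hdomeq χ h i (hx.1 hi')]
    · have hi'' : i + 1 ∉ χ.I := fun hx => hi' ⟨χ, h, hx⟩
      rw [HybridTime.dom_of_succ_notMem hi'',
        HybridTime.dom_of_succ_notMem (show i + 1 ∉ θ.I from hi'), hθτ χ h i hi]
      refine insert_subset_insert ?_
      rw [HybridTime.T_of_succ_notMem hi'',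
        HybridTime.T_of_succ_notMem (show i + 1 ∉ θ.I from hi'), hθτ χ h i hi]
      exact fun t ht => ⟨ht.1, ht.2.trans_le (le_sSup ⟨χ, h, i, hi, hi', rfl⟩)⟩
  have hT : ∀ i ∈ I, ∀ t ∈ θ.T i, ∃ χ ∈ C, i ∈ χ.I ∧ t ∈ χ.T i := by
    intro i hi t ht
    by_cases hi' : i + 1 ∈ I
    · obtain ⟨χ, h, hi'⟩ := id hi'
      have hi := χ.pred_mem i hi'
      refine ⟨χ, h, hi, ?_⟩
      rw [HybridTime.T_of_succ_mem (show i + 1 ∈ θ.I from ⟨χ, h, hi'⟩), hθτ χ h _ hi,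
        hθτ χ h _ hi'] at ht
      rwa [HybridTime.T_of_succ_mem hi']
    · rw [HybridTime.T_of_succ_notMem (show i + 1 ∉ θ.I from hi')] at ht
      obtain ⟨_, ⟨χ, h, j, hj, hj', rfl⟩, hlt⟩ := lt_sSup_iff.1 ht.2
      have h1 : i ≤ j := θ.le_of_mem_of_succ_notMem (show j + 1 ∉ θ.I from hj') hi
      have h2 : j ≤ i := θ.le_of_mem_of_succ_notMem (show i + 1 ∉ θ.I from hi') ⟨χ, h, hj⟩
      obtain rfl : i = j := le_antisymm h1 h2
      refine ⟨χ, h, hj, ?_⟩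
      rw [HybridTime.T_of_succ_notMem (fun hx => hi' ⟨χ, h, hx⟩), ← hθτ χ h _ hj]
      exact ⟨ht.1, hlt⟩
  -- Near each of its times the union interval is covered by a single member, from which continuity
  -- is inherited.
  have hdom : ∀ i ∈ I, ∀ t ∈ θ.dom i,
      ∃ χ ∈ C, i ∈ χ.I ∧ t ∈ χ.dom i ∧ χ.dom i ∈ 𝓝[θ.dom i] t := by
    intro i hi t ht
    by_cases hi' : i + 1 ∈ I
    · obtain ⟨χ, h, hi'⟩ := hi'
      have hi := χ.pred_mem i hi'
      rw [hdomeq χ h i hi'] at ht ⊢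
      exact ⟨χ, h, hi, ht, self_mem_nhdsWithin⟩
    · have hd := HybridTime.dom_of_succ_notMem (show i + 1 ∉ θ.I from hi')
      rw [hd] at ht
      rcases ht with rfl | ht
      · rcases (θ.T i).eq_empty_or_nonempty with he | ⟨s, hs⟩
        · obtain ⟨χ, h, hi⟩ := hi
          have hm : θ.τ i ∈ χ.dom i := by rw [hθτ χ h i hi]; exact χ.left_mem_dom i
          refine ⟨χ, h, hi, hm, ?_⟩
          rw [hd, he]
          exact mem_of_superset self_mem_nhdsWithin (by simpa using hm)
        · obtain ⟨χ, h, hi, hs'⟩ := hT i hi s hs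
          have hm : θ.τ i ∈ χ.dom i := by rw [hθτ χ h i hi]; exact χ.left_mem_dom i
          refine ⟨χ, h, hi, hm, ?_⟩
          filter_upwards [self_mem_nhdsWithin, mem_nhdsWithin_of_mem_nhds (Iio_mem_nhds hs.1)]
            with u hu hus
          refine HybridTime.Icc_subset_dom (χ.T_subset_dom i hs') ⟨?_, (mem_Iio.1 hus).le⟩
          rw [← hθτ χ h i hi]
          exact HybridTime.left_le_of_mem_dom hu
      · obtain ⟨χ, h, hi, ht'⟩ := hT i hi t ht
        exact ⟨χ, h, hi, χ.T_subset_dom i ht', mem_nhdsWithin_of_mem_nhds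
          (mem_of_superset ((χ.isOpen_T i).mem_nhds ht') (χ.T_subset_dom i))⟩
  refine ⟨{ θ with
            p := fun i => (X i).p i
            c := fun i t => (Y i t).c i t
            continuousOn := ?_
            hasDerivAt := ?_
            mem_domain := ?_
            edge_mem := ?_
            mem_guard := ?_
            reset_eq := ?_ }, ?_⟩
  · intro i hi t ht
    obtain ⟨χ, h, hi, ht, hn⟩ := hdom i hi t ht
    refine ContinuousWithinAt.mono_of_mem_nhdsWithin ?_ hn
    exact ((χ.continuousOn i hi) t ht).congr (fun s hs => hc χ h i hi s hs) (hc χ h i hi t ht)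
  · intro i hi t ht
    obtain ⟨χ, h, hi, ht⟩ := hT i hi t ht
    have hd := χ.hasDerivAt i hi t ht
    beta_reduce
    rw [hc χ h i hi t (χ.T_subset_dom i ht), (hτ χ h i hi).2]
    refine hd.congr_of_eventuallyEq ?_
    filter_upwards [(χ.isOpen_T i).mem_nhds ht] with s hs
      using hc χ h i hi s (χ.T_subset_dom i hs)
  · intro i hi t ht
    obtain ⟨χ, h, hi, ht, -⟩ := hdom i hi t ht
    rw [hc χ h i hi t ht, (hτ χ h i hi).2]
    exact χ.mem_domain i hi t ht
  · rintro i ⟨χ, h, hi⟩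
    rw [(hτ χ h _ hi).2, (hτ χ h _ (χ.pred_mem i hi)).2]
    exact χ.edge_mem i hi
  · rintro i ⟨χ, h, hi⟩
    have hi' := χ.pred_mem i hi
    have := χ.mem_guard i hi
    rw [← hc χ h i hi' _ (HybridTime.right_mem_dom hi), ← hθτ χ h _ hi,
      ← (hτ χ h _ hi).2, ← (hτ χ h _ hi').2] at this
    exact this
  · rintro i ⟨χ, h, hi⟩
    have hi' := χ.pred_mem i hi
    have := χ.reset_eq i hi
    rw [← hc χ h i hi' _ (HybridTime.right_mem_dom hi), ← hc χ h _ hi _ (χ.left_mem_dom _),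
      ← hθτ χ h _ hi, ← (hτ χ h _ hi).2, ← (hτ χ h _ hi').2] at this
    exact this
  · intro χ h
    exact ⟨fun i hi => ⟨χ, h, hi⟩, fun i hi => ⟨(hτ χ h i hi).1, (hτ χ h i hi).2,
      hdomsub χ h i hi, fun t ht => hc χ h i hi t ht⟩⟩

/-- Every execution is a prefix of a maximal one. -/
theorem exists_isMaximal_extends (χ : Execution H) :
    ∃ χ' : Execution H, χ'.Extends χ ∧ χ'.IsMaximal := by
  have : Nonempty {χ' : Execution H // χ'.Extends χ} := ⟨⟨χ, Extends.refl χ⟩⟩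
  obtain ⟨m, hm⟩ := exists_maximal_of_nonempty_chains_bounded
    (α := {χ' : Execution H // χ'.Extends χ}) (r := fun a b => b.1.Extends a.1) (by
      intro C hC hne
      have hC' : IsChain (fun a b : Execution H => b.Extends a) (Subtype.val '' C) := by
        rintro _ ⟨a, ha, rfl⟩ _ ⟨b, hb, rfl⟩ hab
        exact hC ha hb fun h => hab (congrArg _ h)
      obtain ⟨ub, hub⟩ := exists_extends_of_isChain hC' (hne.image _)
      obtain ⟨a, ha⟩ := hne
      exact ⟨⟨ub, (hub _ ⟨a, ha, rfl⟩).trans a.2⟩, fun b hb => hub _ ⟨b, hb, rfl⟩⟩)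
    (fun h h' => h'.trans h)
  exact ⟨m.1, m.2, fun χ' h => hm ⟨χ', h.trans m.2⟩ h⟩

/-! ### Prolonging executions that end at a finite time -/

/-- An execution that ends at a finite time with a limit state in a guard set can be prolonged by
a transition. -/
theorem not_isMaximal_of_mem_guard {χ : Execution H} {m : ℕ} {b : ℝ} (hm : m ∈ χ.I)
    (hm' : m + 1 ∉ χ.I) (hb : χ.tEnd = b) {g : ℝ → EuclideanSpace ℝ (Fin n)}
    (hg : ContinuousOn g (Icc (χ.τ m) b))
    (hgc : EqOn g (χ.c m) (insert (χ.τ m) (Ioo (χ.τ m) b))) (hgD : g b ∈ H.D (χ.p m))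
    {q' : Q} (he : (χ.p m, q') ∈ H.E) (hG : g b ∈ H.G (χ.p m, q')) : ¬ χ.IsMaximal := by
  classical
  have hτb : χ.τ m ≤ b := by
    have := χ.τ_le_tEnd m hm hm'
    rwa [hb, EReal.coe_le_coe_iff] at this
  have hle : ∀ i ∈ χ.I, i ≤ m := fun i hi => χ.le_of_mem_of_succ_notMem hm' hi
  have hne : ∀ i ∈ χ.I, i ≠ m + 1 := fun i hi h => hm' (h ▸ hi)
  have hm2 : m + 1 + 1 ∉ insert (m + 1) χ.I := by
    rintro (h | h)
    · omega
    · have := hle _ h; omega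
  have hTm := HybridTime.T_of_tEnd_eq hm' hb
  have hdm := HybridTime.dom_of_succ_notMem hm'
  rw [hTm] at hdm
  let θ : HybridTime :=
    { I := insert (m + 1) χ.I
      zero_mem := Or.inr χ.zero_mem
      pred_mem := by
        rintro i (h | h)
        · obtain rfl : i = m := by omega
          exact Or.inr hm
        · exact Or.inr (χ.pred_mem i h)
      τ := Function.update χ.τ (m + 1) b
      τ_zero := by rw [Function.update_of_ne (by omega)]; exact χ.τ_zero
      -- The new last piece is the single point `b`; its open interval is empty, so it has no
      -- differential equation to satisfy.
      tEnd := b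
      τ_le := by
        rintro i (h | h)
        · obtain rfl : i = m := by omega
          simpa using hτb
        · rw [Function.update_of_ne (hne _ h), Function.update_of_ne (hne _ (χ.pred_mem i h))]
          exact χ.τ_le i h
      τ_le_tEnd := by
        rintro i (rfl | h) h'
        · simp
        · rcases (hle i h).eq_or_lt with rfl | h2
          · exact absurd (Or.inl rfl) h'
          · exact absurd (Or.inr (χ.mem_of_le h2 hm)) h' }
  have hθτ : ∀ i ∈ χ.I, θ.τ i = χ.τ i := fun i hi => Function.update_of_ne (hne i hi) _ _
  have hθb : θ.τ (m + 1) = b := Function.update_self ..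
  have hTθ : θ.T m = Ioo (χ.τ m) b := by
    rw [HybridTime.T_of_succ_mem (show m + 1 ∈ θ.I from Or.inl rfl), hθb, hθτ m hm]
  have hdθ : θ.dom m = Icc (χ.τ m) b := by
    rw [HybridTime.dom_of_succ_mem (show m + 1 ∈ θ.I from Or.inl rfl), hθb, hθτ m hm]
  have hTl : θ.T (m + 1) = ∅ := by
    rw [HybridTime.T_of_tEnd_eq (show m + 1 + 1 ∉ θ.I from hm2) (b := b) rfl, hθb, Ioo_self]
  have hdl : θ.dom (m + 1) = {b} := by
    rw [HybridTime.dom_of_succ_notMem (show m + 1 + 1 ∉ θ.I from hm2), hθb, hTl]; simp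
  have hTi : ∀ i, i + 1 ∈ χ.I → θ.T i = χ.T i := fun i hi => by
    rw [HybridTime.T_of_succ_mem hi, HybridTime.T_of_succ_mem (show i + 1 ∈ θ.I from Or.inr hi),
      hθτ _ hi, hθτ _ (χ.pred_mem i hi)]
  have hdi : ∀ i, i + 1 ∈ χ.I → θ.dom i = χ.dom i := fun i hi => by
    rw [HybridTime.dom_of_succ_mem hi,
      HybridTime.dom_of_succ_mem (show i + 1 ∈ θ.I from Or.inr hi),
      hθτ _ hi, hθτ _ (χ.pred_mem i hi)]
  set p : ℕ → Q := Function.update χ.p (m + 1) q' with hp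
  set c : ℕ → ℝ → EuclideanSpace ℝ (Fin n) := Function.update (Function.update χ.c m g) (m + 1)
    (fun _ => H.φ (χ.p m, q') (g b)) with hc
  have hpi : ∀ i ∈ χ.I, p i = χ.p i := fun i hi => Function.update_of_ne (hne i hi) _ _
  have hpl : p (m + 1) = q' := Function.update_self ..
  have hcm : c m = g := by
    rw [hc, Function.update_of_ne (by omega), Function.update_self]
  have hcl : c (m + 1) = fun _ => H.φ (χ.p m, q') (g b) := Function.update_self ..
  have hci : ∀ i, i + 1 ∈ χ.I → c i = χ.c i := fun i hi => by
    rw [hc, Function.update_of_ne (hne i (χ.pred_mem i hi)),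
      Function.update_of_ne (by rintro rfl; exact hm' hi)]
  have hcτ : ∀ i ∈ χ.I, c i (χ.τ i) = χ.c i (χ.τ i) := fun i hi => by
    rcases (hle i hi).eq_or_lt with rfl | h
    · rw [hcm]; exact hgc (Or.inl rfl)
    · rw [hci i (χ.mem_of_le h hm)]
  have hcases : ∀ i ∈ θ.I, i = m + 1 ∨ i = m ∨ i + 1 ∈ χ.I := by
    rintro i (rfl | h)
    · exact Or.inl rfl
    · rcases (hle i h).eq_or_lt with rfl | h2
      · exact Or.inr (Or.inl rfl)
      · exact Or.inr (Or.inr (χ.mem_of_le h2 hm))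
  let χ' : Execution H :=
    { θ with
      p := p
      c := c
      continuousOn := by
        intro i hi
        rcases hcases i hi with rfl | rfl | h
        · rw [hdl]; exact continuousOn_singleton _ _
        · rwa [hdθ, hcm]
        · rw [hdi i h, hci i h]
          exact χ.continuousOn i (χ.pred_mem i h)
      hasDerivAt := by
        intro i hi t ht
        change t ∈ θ.T i at ht
        rcases hcases i hi with rfl | rfl | h
        · rw [hTl] at ht; exact absurd ht (notMem_empty t)
        · rw [hTθ] at ht
          rw [hcm, hpi i hm, hgc (Or.inr ht)]
          refine (χ.hasDerivAt i hm t (by rwa [hTm])).congr_of_eventuallyEq ?_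
          filter_upwards [isOpen_Ioo.mem_nhds ht] with s hs using hgc (Or.inr hs)
        · rw [hTi i h] at ht
          have hi := χ.pred_mem i h
          rw [hci i h, hpi i hi]
          exact χ.hasDerivAt i hi t ht
      mem_domain := by
        intro i hi t ht
        change t ∈ θ.dom i at ht
        rcases hcases i hi with rfl | rfl | h
        · rw [hcl, hpl]
          exact H.reset_mapsTo _ _ he hG
        · rw [hdθ] at ht
          rw [hcm, hpi i hm]
          rcases ht.2.eq_or_lt with rfl | h2
          · exact hgD
          · have ht' : t ∈ insert (χ.τ i) (Ioo (χ.τ i) b) := by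
              rcases ht.1.eq_or_lt with rfl | h1
              · exact Or.inl rfl
              · exact Or.inr ⟨h1, h2⟩
            rw [hgc ht']
            exact χ.mem_domain i hm t (by rwa [hdm])
        · rw [hdi i h] at ht
          have hi := χ.pred_mem i h
          rw [hci i h, hpi i hi]
          exact χ.mem_domain i hi t ht
      edge_mem := by
        rintro i (hi | hi)
        · obtain rfl : i = m := by omega
          rwa [hpl, hpi i hm]
        · rw [hpi _ hi, hpi _ (χ.pred_mem i hi)]
          exact χ.edge_mem i hi
      mem_guard := by
        rintro i (hi | hi)
        · obtain rfl : i = m := by omega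
          rwa [hpl, hpi i hm, hθb, hcm]
        · rw [hpi _ hi, hpi _ (χ.pred_mem i hi), hθτ _ hi, hci i hi]
          exact χ.mem_guard i hi
      reset_eq := by
        rintro i (hi | hi)
        · obtain rfl : i = m := by omega
          rw [hpl, hpi i hm, hθb, hcm, hcl]
        · rw [hpi _ hi, hpi _ (χ.pred_mem i hi), hθτ _ hi, hci i hi, hcτ _ hi]
          exact χ.reset_eq i hi }
  intro hmax
  refine hm' ((hmax χ' ⟨fun i hi => Or.inr hi, fun i hi => ⟨hθτ i hi, hpi i hi, ?_, ?_⟩⟩).1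
    (Or.inl rfl))
  · change χ.dom i ⊆ θ.dom i
    rcases (hle i hi).eq_or_lt with rfl | h
    · rw [hdm, hdθ]
      exact insert_subset (left_mem_Icc.2 hτb) Ioo_subset_Icc_self
    · rw [hdi i (χ.mem_of_le h hm)]
  · change EqOn (c i) _ _
    rcases (hle i hi).eq_or_lt with rfl | h
    · rw [hdm, hcm]; exact hgc
    · rw [hci i (χ.mem_of_le h hm)]
      exact fun _ _ => rfl

/-- An execution that ends at a finite time `b` can be prolonged if its last piece can be prolonged
to a solution on a larger interval. -/
theorem not_isMaximal_of_flow {χ : Execution H} {m : ℕ} {b ε : ℝ} (hm : m ∈ χ.I)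
    (hm' : m + 1 ∉ χ.I) (hb : χ.tEnd = b) (hε : 0 < ε) {g : ℝ → EuclideanSpace ℝ (Fin n)}
    (hg : ContinuousOn g (Ico (χ.τ m) (b + ε)))
    (hgc : EqOn g (χ.c m) (insert (χ.τ m) (Ioo (χ.τ m) b)))
    (hgD : ∀ t ∈ Ico (χ.τ m) (b + ε), g t ∈ H.D (χ.p m))
    (hgd : ∀ t ∈ Ioo (χ.τ m) (b + ε), HasDerivAt g (H.f (χ.p m) (g t)) t) :
    ¬ χ.IsMaximal := by
  classical
  have hτb : χ.τ m ≤ b := by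
    have := χ.τ_le_tEnd m hm hm'
    rwa [hb, EReal.coe_le_coe_iff] at this
  have hle : ∀ i ∈ χ.I, i ≤ m := fun i hi => χ.le_of_mem_of_succ_notMem hm' hi
  have hTm := HybridTime.T_of_tEnd_eq hm' hb
  have hdm := HybridTime.dom_of_succ_notMem hm'
  rw [hTm] at hdm
  let θ : HybridTime :=
    { χ.toHybridTime with
      tEnd := ((b + ε : ℝ) : EReal)
      τ_le_tEnd := fun i h h' => (χ.τ_le_tEnd i h h').trans (by
        rw [hb, EReal.coe_le_coe_iff]; linarith) }
  have hTθ : θ.T m = Ioo (χ.τ m) (b + ε) :=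
    HybridTime.T_of_tEnd_eq (show m + 1 ∉ θ.I from hm') (b := b + ε) rfl
  have hdθ : θ.dom m = Ico (χ.τ m) (b + ε) := by
    rw [HybridTime.dom_of_succ_notMem (show m + 1 ∉ θ.I from hm'), hTθ]
    exact Ioo_insert_left (by linarith)
  have hTi : ∀ i, i + 1 ∈ χ.I → θ.T i = χ.T i := fun i hi => by
    rw [HybridTime.T_of_succ_mem hi, HybridTime.T_of_succ_mem (show i + 1 ∈ θ.I from hi)]
  have hdi : ∀ i, i + 1 ∈ χ.I → θ.dom i = χ.dom i := fun i hi => by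
    rw [HybridTime.dom_of_succ_mem hi,
      HybridTime.dom_of_succ_mem (show i + 1 ∈ θ.I from hi)]
  set c : ℕ → ℝ → EuclideanSpace ℝ (Fin n) := Function.update χ.c m g with hc
  have hcm : c m = g := Function.update_self ..
  have hci : ∀ i, i + 1 ∈ χ.I → c i = χ.c i := fun i hi =>
    Function.update_of_ne (by rintro rfl; exact hm' hi) _ _
  have hcτ : ∀ i ∈ χ.I, c i (χ.τ i) = χ.c i (χ.τ i) := fun i hi => by
    rcases (hle i hi).eq_or_lt with rfl | h
    · rw [hcm]; exact hgc (Or.inl rfl)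
    · rw [hci i (χ.mem_of_le h hm)]
  have hcases : ∀ i ∈ χ.I, i = m ∨ i + 1 ∈ χ.I := by
    intro i h
    rcases (hle i h).eq_or_lt with rfl | h2
    · exact Or.inl rfl
    · exact Or.inr (χ.mem_of_le h2 hm)
  let χ' : Execution H :=
    { θ with
      p := χ.p
      c := c
      continuousOn := by
        intro i hi
        rcases hcases i hi with rfl | h
        · rwa [hdθ, hcm]
        · rw [hdi i h, hci i h]
          exact χ.continuousOn i hi
      hasDerivAt := by
        intro i hi t ht
        change t ∈ θ.T i at ht
        rcases hcases i hi with rfl | h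
        · rw [hTθ] at ht
          rw [hcm]
          exact hgd t ht
        · rw [hTi i h] at ht
          rw [hci i h]
          exact χ.hasDerivAt i hi t ht
      mem_domain := by
        intro i hi t ht
        change t ∈ θ.dom i at ht
        rcases hcases i hi with rfl | h
        · rw [hdθ] at ht
          rw [hcm]
          exact hgD t ht
        · rw [hdi i h] at ht
          rw [hci i h]
          exact χ.mem_domain i hi t ht
      edge_mem := χ.edge_mem
      mem_guard := fun i hi => by
        rw [hci i hi]
        exact χ.mem_guard i hi
      reset_eq := fun i hi => by
        change c (i + 1) (χ.τ (i + 1)) = H.φ _ (c i (χ.τ (i + 1)))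
        rw [hci i hi, hcτ _ hi]
        exact χ.reset_eq i hi }
  intro hmax
  have hext : χ'.Extends χ := by
    refine ⟨subset_rfl, fun i hi => ⟨rfl, rfl, ?_, ?_⟩⟩
    · change χ.dom i ⊆ θ.dom i
      rcases hcases i hi with rfl | h
      · rw [hdm, hdθ]
        exact insert_subset ⟨le_rfl, by linarith⟩
          fun t ht => ⟨ht.1.le, by linarith [ht.2]⟩
      · rw [hdi i h]
    · change EqOn (c i) _ _
      rcases hcases i hi with rfl | h
      · rw [hdm, hcm]; exact hgc
      · rw [hci i h]
        exact fun _ _ => rfl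
  -- Maximality would put `b + ε / 2`, a time of the prolonged piece, into the old one, which has no
  -- times after `b`.
  have hsub : θ.dom m ⊆ χ.dom m := ((hmax χ' hext).2 m hm).2.2.1
  rw [hdθ, hdm] at hsub
  rcases hsub (show b + ε / 2 ∈ _ from ⟨by linarith, by linarith⟩) with h | h
  · linarith
  · linarith [h.2]

/-- An execution that ends at a finite time is not maximal if its last piece has a limit state,
in the domain, at which the system does not block. -/
theorem not_isMaximal_of_nonblockingAt {χ : Execution H} {m : ℕ} {b : ℝ} (hm : m ∈ χ.I)
    (hm' : m + 1 ∉ χ.I) (hb : χ.tEnd = b) (hf : ContinuousOn (H.f (χ.p m)) (H.D (χ.p m)))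
    {g : ℝ → EuclideanSpace ℝ (Fin n)} (hg : ContinuousOn g (Icc (χ.τ m) b))
    (hgc : EqOn g (χ.c m) (insert (χ.τ m) (Ioo (χ.τ m) b)))
    (hgD : ∀ t ∈ Icc (χ.τ m) b, g t ∈ H.D (χ.p m))
    (hgd : ∀ t ∈ Ioo (χ.τ m) b, HasDerivAt g (H.f (χ.p m) (g t)) t)
    (hnb : H.NonblockingAt (χ.p m) (g b)) : ¬ χ.IsMaximal := by
  have hτb : χ.τ m ≤ b := by
    have := χ.τ_le_tEnd m hm hm'
    rwa [hb, EReal.coe_le_coe_iff] at this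
  rcases hnb with ⟨ε, hε, d, hd0, hd, hdD⟩ | ⟨q', he, hG⟩
  · obtain ⟨k, hkg, hk, hkD, hkd⟩ := exists_concat_solution hf hτb hε hg hgD hgd hd
      (fun t ht => (hdD t ht).1) (fun t ht => (hdD t ht).2) hd0
    refine not_isMaximal_of_flow hm hm' hb hε hk (fun t ht => ?_) hkD hkd
    rw [← hgc ht]
    refine hkg ?_
    rcases ht with rfl | ht
    · exact hτb
    · exact ht.2.le
  · exact not_isMaximal_of_mem_guard hm hm' hb hg hgc (hgD b (right_mem_Icc.2 hτb)) he hG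

end Execution

/-! ### Recurrence of modes -/

/-- In a cyclic system every mode is visited infinitely often by each infinite sequence of
transitions. -/
theorem IsCyclic.frequently_eq [Finite Q] (hcyc : H.IsCyclic) {p : ℕ → Q}
    (hp : ∀ i, (p i, p (i + 1)) ∈ H.E) (q : Q) : ∃ᶠ i in atTop, p i = q := by
  have hout : ∀ a, ∃ b, (a, b) ∈ H.E ∧ ∀ b', (a, b') ∈ H.E → b' = b := by
    intro a
    obtain ⟨⟨a', b⟩, ⟨he, rfl⟩, hu⟩ := hcyc.out a
    exact ⟨b, he, fun b' h => congrArg Prod.snd (hu (a', b') ⟨h, rfl⟩)⟩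
  choose σ hσ hσu using hout
  -- The successor map is injective by uniqueness of incoming edges, hence a permutation of the
  -- finite set `Q`; connectedness makes it a single cycle.
  have hinj : Function.Injective σ := by
    intro a a' h
    obtain ⟨e, -, hu⟩ := hcyc.into (σ a)
    have h1 := hu (a, σ a) ⟨hσ a, rfl⟩
    have h2 := hu (a', σ a') ⟨hσ a', h.symm⟩
    exact congrArg Prod.fst (h1.trans h2.symm)
  let s : Equiv.Perm Q := Equiv.ofBijective σ (Finite.injective_iff_bijective.1 hinj)
  have hs : ∀ a, s a = σ a := fun _ => rfl
  have hsame : ∀ a b, s.SameCycle a b := by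
    intro a b
    induction hcyc.connected a b with
    | rel x y h =>
      rw [hσu x y h, ← hs]
      exact Equiv.Perm.sameCycle_apply_right.2 (Equiv.Perm.SameCycle.refl _ _)
    | refl x => exact Equiv.Perm.SameCycle.refl _ _
    | symm x y _ ih => exact ih.symm
    | trans x y w _ _ ih ih' => exact ih.trans ih'
  have hpow : ∀ N k, p (N + k) = (s ^ k) (p N) := by
    intro N k
    induction k with
    | zero => rfl
    | succ k ih =>
      rw [pow_succ', Equiv.Perm.mul_apply, ← ih, hs]
      exact hσu _ _ (hp (N + k))
  rw [frequently_atTop]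
  intro N
  obtain ⟨k, hk⟩ := (hsame (p N) q).exists_nat_pow_eq
  exact ⟨N + k, by omega, (hpow N k).trans hk⟩

/-! ### Executions in a decay region -/

/-- A family of sets `S q` that no execution leaves and on which `V` decreases: at rate `γ` along
solutions, by the factor `r q` at transitions. -/
structure IsDecayRegion (H : HybridSystem Q n) (S : Q → Set (EuclideanSpace ℝ (Fin n)))
    (V : Q → EuclideanSpace ℝ (Fin n) → ℝ) (r : Q → ℝ) (γ : ℝ) : Prop where
  flow : ∀ (q : Q) (a b : ℝ) (c : ℝ → EuclideanSpace ℝ (Fin n)), a ≤ b →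
    ContinuousOn c (Icc a b) → (∀ t ∈ Icc a b, c t ∈ H.D q) →
    (∀ t ∈ Ioo a b, HasDerivAt c (H.f q (c t)) t) → c a ∈ S q →
    c b ∈ S q ∧ V q (c b) ≤ V q (c a) - γ * (b - a)
  jump : ∀ q q', (q, q') ∈ H.E → ∀ x ∈ H.G (q, q') ∩ S q,
    H.φ (q, q') x ∈ S q' ∧ V q' (H.φ (q, q') x) ≤ r q * V q x
  nonneg : ∀ q, ∀ x ∈ S q, 0 ≤ V q x
  bounded : ∀ q, ∃ C, ∀ x ∈ S q, ‖H.f q x‖ ≤ C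
  nonblocking : ∀ q, ∀ x ∈ S q, H.NonblockingAt q x

namespace IsDecayRegion

variable {S : Q → Set (EuclideanSpace ℝ (Fin n))} {V : Q → EuclideanSpace ℝ (Fin n) → ℝ}
  {r : Q → ℝ} {γ : ℝ}

theorem flow_of_mem_dom (hS : H.IsDecayRegion S V r γ) {χ : Execution H} {i : ℕ} (hi : i ∈ χ.I)
    (h : χ.c i (χ.τ i) ∈ S (χ.p i)) {t : ℝ} (ht : t ∈ χ.dom i) :
    χ.c i t ∈ S (χ.p i) ∧
      V (χ.p i) (χ.c i t) ≤ V (χ.p i) (χ.c i (χ.τ i)) - γ * (t - χ.τ i) :=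
  hS.flow _ _ _ _ (HybridTime.left_le_of_mem_dom ht)
    ((χ.continuousOn i hi).mono (HybridTime.Icc_subset_dom ht))
    (fun s hs => χ.mem_domain i hi s (HybridTime.Icc_subset_dom ht hs))
    (fun s hs => χ.hasDerivAt i hi s (HybridTime.Ioo_subset_T ht hs)) h

theorem left_mem (hS : H.IsDecayRegion S V r γ) {χ : Execution H} {q₀ : Q}
    {x₀ : EuclideanSpace ℝ (Fin n)} (hx₀ : x₀ ∈ S q₀) (hχ : χ.StartsAt q₀ x₀) {i : ℕ}
    (hi : i ∈ χ.I) : χ.c i (χ.τ i) ∈ S (χ.p i) := by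
  induction i with
  | zero => rw [χ.τ_zero, hχ.1, hχ.2]; exact hx₀
  | succ i ih =>
    rw [χ.reset_eq i hi]
    have hi' := χ.pred_mem i hi
    exact (hS.jump _ _ (χ.edge_mem i hi) _ ⟨χ.mem_guard i hi,
      (hS.flow_of_mem_dom hi' (ih hi') (HybridTime.right_mem_dom hi)).1⟩).1

/-- A last piece can be neither infinite, since `V` is nonnegative and falls at rate `γ`, nor
finite, since its limit state stays in `S` and does not block. -/
theorem I_eq_univ (hS : H.IsDecayRegion S V r γ) (hγ : 0 < γ) (hD : ∀ q, IsClosed (H.D q))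
    (hf : ∀ q, ContinuousOn (H.f q) (H.D q)) {χ : Execution H} {q₀ : Q}
    {x₀ : EuclideanSpace ℝ (Fin n)} (hx₀ : x₀ ∈ S q₀) (hχ : χ.StartsAt q₀ x₀)
    (hmax : χ.IsMaximal) : χ.I = univ := by
  by_contra hI
  have hlast : ∃ m ∈ χ.I, m + 1 ∉ χ.I := by
    by_contra! h
    exact hI (eq_univ_of_forall fun i => Nat.rec χ.zero_mem h i)
  obtain ⟨m, hm, hm'⟩ := hlast
  have hleft := hS.left_mem hx₀ hχ hm
  have hle := χ.τ_le_tEnd m hm hm'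
  have hbot : χ.tEnd ≠ ⊥ := fun h => by simp [h] at hle
  have htop : χ.tEnd ≠ ⊤ := by
    intro h
    set v := V (χ.p m) (χ.c m (χ.τ m))
    have hv : 0 ≤ v := hS.nonneg _ _ hleft
    -- After time `(v + 1) / γ` the decay estimate would give a value of at most `-1`.
    have hpos : 0 < (v + 1) / γ := by positivity
    have ht : χ.τ m + (v + 1) / γ ∈ χ.dom m := by
      refine χ.T_subset_dom m ?_
      rw [HybridTime.T_of_succ_notMem hm', h]
      exact ⟨by linarith, EReal.coe_lt_top _⟩
    obtain ⟨h1, h2⟩ := hS.flow_of_mem_dom hm hleft ht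
    have h3 := hS.nonneg _ _ h1
    rw [add_sub_cancel_left, mul_div_cancel₀ _ hγ.ne'] at h2
    linarith
  obtain ⟨b, hb⟩ : ∃ b : ℝ, χ.tEnd = b := ⟨_, (EReal.coe_toReal htop hbot).symm⟩
  have hτb : χ.τ m ≤ b := by rwa [hb, EReal.coe_le_coe_iff] at hle
  have hT := HybridTime.T_of_tEnd_eq hm' hb
  have hdom := HybridTime.dom_of_succ_notMem hm'
  rw [hT] at hdom
  have hder : ∀ t ∈ Ioo (χ.τ m) b, HasDerivAt (χ.c m) (H.f (χ.p m) (χ.c m t)) t :=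
    fun t ht => χ.hasDerivAt m hm t (by rwa [hT])
  obtain ⟨C, hC⟩ := hS.bounded (χ.p m)
  obtain ⟨g, hg, hgc⟩ := exists_continuousOn_Icc_of_bounded_deriv hτb
    (by rw [← hdom]; exact χ.continuousOn m hm) hder
    (fun t ht => hC _ (hS.flow_of_mem_dom hm hleft (hdom ▸ Or.inr ht)).1)
  have hgd : ∀ t ∈ Ioo (χ.τ m) b, HasDerivAt g (H.f (χ.p m) (g t)) t := fun t ht => by
    rw [hgc (Or.inr ht)]
    refine (hder t ht).congr_of_eventuallyEq ?_
    filter_upwards [isOpen_Ioo.mem_nhds ht] with s hs using hgc (Or.inr hs)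
  have hgD' : ∀ t ∈ insert (χ.τ m) (Ioo (χ.τ m) b), g t ∈ H.D (χ.p m) := fun t ht => by
    rw [hgc ht]; exact χ.mem_domain m hm t (by rwa [hdom])
  -- The limit state at `b` lies in the domain because the domain is closed.
  have hgD : ∀ t ∈ Icc (χ.τ m) b, g t ∈ H.D (χ.p m) := by
    have hcl : closure (insert (χ.τ m) (Ioo (χ.τ m) b)) = Icc (χ.τ m) b := by
      rcases hτb.eq_or_lt with h | h
      · simp [h]
      · rw [Ioo_insert_left h, closure_Ico h.ne]
    intro t ht
    have h1 : MapsTo g (closure (insert (χ.τ m) (Ioo (χ.τ m) b))) (closure (H.D (χ.p m))) :=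
      MapsTo.closure_of_continuousOn hgD' (by rwa [hcl])
    rw [hcl, (hD _).closure_eq] at h1
    exact h1 ht
  have hga : g (χ.τ m) ∈ S (χ.p m) := by rwa [hgc (Or.inl rfl)]
  exact Execution.not_isMaximal_of_nonblockingAt hm hm' hb (hf _) hg hgc hgD hgd
    (hS.nonblocking _ _ (hS.flow _ _ _ g hτb hg hgD hgd hga).1) hmax

theorem isZeno_and_tendsto [Finite Q] (hS : H.IsDecayRegion S V r γ) (hγ : 0 < γ)
    (hcyc : H.IsCyclic) (hr1 : ∀ q, r q ≤ 1) (hr : ∃ q, r q < 1) {χ : Execution H} {q₀ : Q}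
    {x₀ : EuclideanSpace ℝ (Fin n)} (hx₀ : x₀ ∈ S q₀) (hχ : χ.StartsAt q₀ x₀)
    (hI : χ.I = univ) :
    χ.IsZeno ∧ (∀ i, χ.c i (χ.τ (i + 1)) ∈ S (χ.p i)) ∧
      Tendsto (fun i => V (χ.p i) (χ.c i (χ.τ (i + 1)))) atTop (𝓝 0) := by
  have hmem : ∀ i, i ∈ χ.I := fun i => hI ▸ mem_univ i
  set v : ℕ → ℝ := fun i => V (χ.p i) (χ.c i (χ.τ i)) with hv
  set w : ℕ → ℝ := fun i => V (χ.p i) (χ.c i (χ.τ (i + 1))) with hw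
  have hleft : ∀ i, χ.c i (χ.τ i) ∈ S (χ.p i) := fun i => hS.left_mem hx₀ hχ (hmem i)
  have hflow : ∀ i, _ := fun i => hS.flow_of_mem_dom (hmem i) (hleft i)
    (HybridTime.right_mem_dom (hmem (i + 1)))
  have hw0 : ∀ i, 0 ≤ w i := fun i => hS.nonneg _ _ (hflow i).1
  have hv0 : ∀ i, 0 ≤ v i := fun i => hS.nonneg _ _ (hleft i)
  have hwv : ∀ i, w i ≤ v i - γ * (χ.τ (i + 1) - χ.τ i) := fun i => (hflow i).2
  have hτ : ∀ i, χ.τ i ≤ χ.τ (i + 1) := fun i => χ.τ_le i (hmem _)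
  have hwv' : ∀ i, w i ≤ v i := fun i => by
    have := mul_nonneg hγ.le (sub_nonneg.2 (hτ i)); linarith [hwv i]
  have hvr : ∀ i, v (i + 1) ≤ r (χ.p i) * w i := fun i => by
    have := (hS.jump _ _ (χ.edge_mem i (hmem _)) _ ⟨χ.mem_guard i (hmem _), (hflow i).1⟩).2
    rwa [← χ.reset_eq i (hmem _)] at this
  have hvw : ∀ i, v (i + 1) ≤ w i := fun i =>
    (hvr i).trans (mul_le_of_le_one_left (hw0 i) (hr1 _))
  have hanti : Antitone v := antitone_nat_of_succ_le fun i => (hvw i).trans (hwv' i)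
  have hlim := tendsto_atTop_ciInf hanti ⟨0, by rintro _ ⟨i, rfl⟩; exact hv0 i⟩
  set L := ⨅ i, v i
  have hL0 : 0 ≤ L := ge_of_tendsto' hlim hv0
  have hL : L = 0 := by
    obtain ⟨q, hq⟩ := hr
    have hfr := hcyc.frequently_eq (fun i => χ.edge_mem i (hmem _)) q
    -- A decay region does not require `r q ≥ 0`. If `r q` is negative, the values of `v` right
    -- after visits to `q` are nonpositive, which also forces `L = 0`.
    by_cases hrq : 0 ≤ r q
    · have h1 : L ≤ r q * L :=
        le_of_tendsto_of_tendsto_of_frequently ((tendsto_add_atTop_iff_nat 1).2 hlim)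
          (hlim.const_mul (r q)) (hfr.mono fun i hi => by
            have := hvr i
            rw [hi] at this
            exact this.trans (mul_le_mul_of_nonneg_left (hwv' i) hrq))
      nlinarith
    · have h1 : L ≤ 0 := le_of_tendsto_of_frequently ((tendsto_add_atTop_iff_nat 1).2 hlim)
        (hfr.mono fun i hi => by
          have := hvr i
          rw [hi] at this
          exact this.trans (mul_nonpos_of_nonpos_of_nonneg (not_le.1 hrq).le (hw0 i)))
      exact le_antisymm h1 hL0
  rw [hL] at hlim
  refine ⟨⟨hI, _, tendsto_atTop_ciSup (monotone_nat_of_le_succ hτ) ⟨v 0 / γ, ?_⟩⟩,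
    fun i => (hflow i).1, squeeze_zero hw0 hwv' hlim⟩
  rintro _ ⟨i, rfl⟩
  -- The quantity `v i + γ * χ.τ i` never increases, so all transition times are at most `v 0 / γ`.
  have hsum : ∀ i, v i + γ * χ.τ i ≤ v 0 := by
    intro i
    induction i with
    | zero => simp [χ.τ_zero]
    | succ i ih => linarith [hvw i, hwv i]
  rw [le_div_iff₀ hγ]
  linarith [hsum i, hv0 i]

end IsDecayRegion

/-! ### Compactness, construction of the decay region, and the theorem -/

/-- Positive functions `V q` have a common positive lower bound on compact spherical shells. -/
theorem exists_pos_le_of_annulus [Finite Q] (hD : ∀ q, IsClosed (H.D q))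
    {z : Q → EuclideanSpace ℝ (Fin n)} {V : Q → EuclideanSpace ℝ (Fin n) → ℝ} {R ρ : Q → ℝ}
    (hV : ∀ q, ContinuousOn (V q) (H.D q ∩ Metric.closedBall (z q) (R q)))
    (hpos : ∀ q, ∀ x ∈ H.D q ∩ Metric.closedBall (z q) (R q), x ≠ z q → 0 < V q x)
    (hρ : ∀ q, 0 < ρ q) :
    ∃ a > 0, ∀ q, ∀ x ∈ H.D q, ρ q ≤ dist x (z q) → dist x (z q) ≤ R q → a ≤ V q x := by
  -- Stated for all small `a > 0`, so that the bounds for the finitely many modes can be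
  -- intersected.
  have h1 : ∀ q, ∀ᶠ a in 𝓝[>] (0 : ℝ),
      ∀ x ∈ H.D q, ρ q ≤ dist x (z q) → dist x (z q) ≤ R q → a ≤ V q x := by
    intro q
    set K := H.D q ∩ Metric.closedBall (z q) (R q) ∩ {x | ρ q ≤ dist x (z q)} with hK
    have hKc : IsCompact K :=
      ((isCompact_closedBall (z q) (R q)).inter_left (hD q)).inter_right
        (isClosed_le continuous_const (continuous_id.dist continuous_const))
    rcases K.eq_empty_or_nonempty with he | hne
    · refine Eventually.of_forall fun a x hx h h' => ?_
      exact absurd (show x ∈ K from ⟨⟨hx, h'⟩, h⟩) (he ▸ notMem_empty x)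
    · obtain ⟨y, hy, hmin⟩ := hKc.exists_isMinOn hne ((hV q).mono inter_subset_left)
      have hyz : y ≠ z q := by
        rintro rfl
        have := hy.2
        simp only [mem_ofPred_eq, dist_self] at this
        exact absurd (hρ q) (not_lt.2 this)
      filter_upwards [Ioo_mem_nhdsGT (hpos q y hy.1 hyz)] with a ha x hx h h'
      exact ha.2.le.trans (hmin (show x ∈ K from ⟨⟨hx, h'⟩, h⟩))
  obtain ⟨a, ha, ha0⟩ := ((eventually_all.2 h1).and self_mem_nhdsWithin).exists
  exact ⟨a, ha0, ha⟩

end HybridSystem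

open HybridSystem in
theorem mainTheorem2 {Q : Type*} [Finite Q] {n : ℕ} (H : HybridSystem Q n)
    (hcyc : H.IsCyclic)
    (hD : ∀ q, IsClosed (H.D q))
    (hf : ∀ q, ContinuousOn (H.f q) (H.D q))
    (hφ : ∀ e ∈ H.E, ContinuousOn (H.φ e) (H.G e))
    (z : Q → EuclideanSpace ℝ (Fin n)) (hz : H.IsZenoEquilibrium z)
    (W : Q → Set (EuclideanSpace ℝ (Fin n)))
    (hWD : ∀ q, W q ⊆ H.D q) (hW : ∀ q, W q ∈ 𝓝[H.D q] (z q))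
    (hnb : ∀ q, ∀ x ∈ W q, H.NonblockingAt q x)
    (V : Q → EuclideanSpace ℝ (Fin n) → ℝ)
    (gradV : Q → EuclideanSpace ℝ (Fin n) → EuclideanSpace ℝ (Fin n))
    (hV : ∀ q, ∀ x ∈ W q, HasGradientWithinAt (V q) (gradV q x) (W q) x)
    (hgradV : ∀ q, ContinuousOn (gradV q) (W q))
    (r : Q → ℝ) (hr0 : ∀ q, 0 < r q) (hr1 : ∀ q, r q ≤ 1) (hr : ∃ q, r q < 1)
    (γ : ℝ) (hγ : 0 < γ)
    (hpos : ∀ q, ∀ x ∈ W q, x ≠ z q → 0 < V q x)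
    (hzero : ∀ q, V q (z q) = 0)
    (hdecr : ∀ q, ∀ x ∈ W q, inner ℝ (gradV q x) (H.f q x) ≤ -γ)
    (hjump : ∀ q q', (q, q') ∈ H.E → ∀ x ∈ H.G (q, q') ∩ W q,
      H.φ (q, q') x ∈ W q' → V q' (H.φ (q, q') x) ≤ r q * V q x) :
    H.IsZenoStable z := by
  have hball : ∀ q, ∃ R > 0, H.D q ∩ Metric.closedBall (z q) R ⊆ W q := by
    intro q
    obtain ⟨R, hR, hsub⟩ := (nhdsWithin_hasBasis Metric.nhds_basis_closedBall _).mem_iff.1 (hW q)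
    exact ⟨R, hR, by rwa [inter_comm]⟩
  choose R hR hRW using hball
  have hVc : ∀ q, ContinuousOn (V q) (W q) := fun q x hx => (hV q x hx).continuousWithinAt
  have hWz : ∀ q, z q ∈ W q := fun q => mem_of_mem_nhdsWithin (hz.mem_domain q) (hW q)
  have hV0 : ∀ q, ∀ x ∈ W q, 0 ≤ V q x := fun q x hx => by
    by_cases h : x = z q
    · rw [h, hzero]
    · exact (hpos q x hx h).le
  have hlow : ∀ ρ : Q → ℝ, (∀ q, 0 < ρ q) →
      ∃ a > 0, ∀ q, ∀ x ∈ H.D q, ρ q ≤ dist x (z q) → dist x (z q) ≤ R q → a ≤ V q x :=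
    fun ρ hρ => exists_pos_le_of_annulus hD (fun q => (hVc q).mono (hRW q))
      (fun q x hx => hpos q x (hRW q hx)) hρ
  have hreset : ∀ q, ∃ ρ > 0, ρ ≤ R q ∧ ∀ q', (q, q') ∈ H.E → ∀ x ∈ H.G (q, q'),
      dist x (z q) < ρ → dist (H.φ (q, q') x) (z q') < R q' := by
    intro q
    obtain ⟨⟨_, q₁⟩, ⟨he, rfl⟩, hu⟩ := hcyc.out q
    have hc := hφ _ he (z _) (hz.mem_guard _ _ he)
    rw [Metric.continuousWithinAt_iff] at hc
    obtain ⟨δ, hδ, h⟩ := hc (R q₁) (hR q₁)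
    -- One `δ` suffices, since `q` has only one outgoing edge.
    refine ⟨min δ (R _), lt_min hδ (hR _), min_le_right _ _, fun q' he' x hx hd => ?_⟩
    obtain rfl : q' = q₁ := congrArg Prod.snd (hu (_, q') ⟨he', rfl⟩)
    have := h hx (hd.trans_le (min_le_left _ _))
    rwa [hz.reset_eq _ _ he] at this
  choose ρ hρ hρR hρφ using hreset
  obtain ⟨a, ha, haV⟩ := hlow ρ hρ
  set S : Q → Set (EuclideanSpace ℝ (Fin n)) :=
    fun q => {x | x ∈ H.D q ∧ dist x (z q) < R q ∧ V q x < a} with hSdef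
  have hSW : ∀ q, S q ⊆ W q := fun q x hx => hRW q ⟨hx.1, hx.2.1.le⟩
  have hS : H.IsDecayRegion S V r γ := by
    refine ⟨?_, ?_, fun q x hx => hV0 q x (hSW q hx), fun q => ?_,
      fun q x hx => hnb q x (hSW q hx)⟩
    · intro q s b c hsb hc hcD hcd hcs
      have hdecay : ∀ t ∈ Icc s b, (∀ u ∈ Icc s t, dist (c u) (z q) ≤ R q) →
          V q (c t) ≤ V q (c s) - γ * (t - s) := fun t ht h =>
        lyapunov_decay (hV q) (hdecr q) ht.1 (hc.mono (Icc_subset_Icc_right ht.2))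
          (fun u hu => hRW q ⟨hcD u ⟨hu.1, hu.2.trans ht.2⟩, h u hu⟩)
          (fun u hu => hcd u ⟨hu.1, hu.2.trans_le ht.2⟩)
      have hdist : ContinuousOn (fun t => dist (c t) (z q)) (Icc s b) :=
        (continuous_id.dist continuous_const).comp_continuousOn hc
      -- At the first time with distance at least `R q`, continuity gives distance exactly `R q`.
      -- The curve has stayed in `W q` until then, so decay gives `V < a`, against `V ≥ a` on the
      -- shell.
      have hstay : ∀ t ∈ Icc s b, dist (c t) (z q) < R q := by
        by_contra! hex
        obtain ⟨t₁, ht₁, hR₁⟩ := hex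
        have hcomp : IsCompact (Icc s b ∩ (fun t => dist (c t) (z q)) ⁻¹' Ici (R q)) :=
          isCompact_Icc.of_isClosed_subset
            (hdist.preimage_isClosed_of_isClosed isClosed_Icc isClosed_Ici) inter_subset_left
        obtain ⟨t, ⟨ht, htR⟩, hmin⟩ := hcomp.exists_isLeast ⟨t₁, ht₁, hR₁⟩
        have hbefore : ∀ u ∈ Ico s t, dist (c u) (z q) ≤ R q := fun u hu => by
          by_contra h
          exact absurd (hmin ⟨⟨hu.1, hu.2.le.trans ht.2⟩, (not_le.1 h).le⟩) (not_le.2 hu.2)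
        have hst : s < t := by
          rcases ht.1.eq_or_lt with rfl | h
          · exact absurd hcs.2.1 (not_lt.2 htR)
          · exact h
        have hat : dist (c t) (z q) ≤ R q := by
          have h1 : MapsTo (fun t => dist (c t) (z q)) (closure (Ico s t)) (closure (Iic (R q))) :=
            MapsTo.closure_of_continuousOn hbefore
              (by rw [closure_Ico hst.ne]; exact hdist.mono (Icc_subset_Icc_right ht.2))
          rw [closure_Ico hst.ne, closure_Iic] at h1
          exact h1 (right_mem_Icc.2 hst.le)
        have h2 := hdecay t ht fun u hu => by
          rcases hu.2.eq_or_lt with rfl | h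
          · exact hat
          · exact hbefore u ⟨hu.1, h⟩
        have h3 := haV q (c t) (hcD t ht) ((hρR q).trans htR) hat
        have h4 := mul_nonneg hγ.le (sub_nonneg.2 hst.le)
        linarith [hcs.2.2]
      have hb := right_mem_Icc.2 hsb
      have hle := hdecay b hb fun u hu => (hstay u hu).le
      have h4 := mul_nonneg hγ.le (sub_nonneg.2 hsb)
      exact ⟨⟨hcD b hb, hstay b hb, by linarith [hcs.2.2]⟩, hle⟩
    · rintro q q' he x ⟨hxG, hxS⟩
      -- As `V q x < a`, the point is not in the shell, so it is close enough to `z q` for the reset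
      -- to land in the next ball.
      have hxρ : dist x (z q) < ρ q := by
        by_contra h
        exact absurd (haV q x hxS.1 (not_lt.1 h) hxS.2.1.le) (not_le.2 hxS.2.2)
      have hφD := H.reset_mapsTo q q' he hxG
      have hφR := hρφ q q' he x hxG hxρ
      have hle := hjump q q' he x ⟨hxG, hSW q hxS⟩ (hRW q' ⟨hφD, hφR.le⟩)
      refine ⟨⟨hφD, hφR, hle.trans_lt (lt_of_le_of_lt ?_ hxS.2.2)⟩, hle⟩
      exact mul_le_of_le_one_left (hV0 q x (hSW q hxS)) (hr1 q)
    · obtain ⟨C, hC⟩ := ((isCompact_closedBall (z q) (R q)).inter_left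
        (hD q)).exists_bound_of_continuousOn ((hf q).mono inter_subset_left)
      exact ⟨C, fun x hx => hC x ⟨hx.1, hx.2.1.le⟩⟩
  refine ⟨S, fun q => ⟨fun x hx => hx.1, ?_⟩, fun q₀ x₀ hx₀ => ⟨?_, fun χ hχ hmax => ?_⟩⟩
  · have h1 : ∀ᶠ x in 𝓝[W q] (z q), V q x < a :=
      (hVc q (z q) (hWz q)).eventually_lt_const (by rwa [hzero])
    have h2 : 𝓝[H.D q] (z q) ≤ 𝓝[W q] (z q) :=
      le_inf nhdsWithin_le_nhds (le_principal_iff.2 (hW q))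
    filter_upwards [self_mem_nhdsWithin, h2 h1,
      mem_nhdsWithin_of_mem_nhds (Metric.ball_mem_nhds (z q) (hR q))] with x hx hx' hx''
    exact ⟨hx, hx'', hx'⟩
  · obtain ⟨χ, hext, hmax⟩ :=
      Execution.exists_isMaximal_extends (Execution.point (H := H) q₀ x₀ hx₀.1)
    exact ⟨χ, Execution.StartsAt.of_extends ⟨rfl, rfl⟩ hext, hmax⟩
  · obtain ⟨hZ, hmem, hlim⟩ := hS.isZeno_and_tendsto hγ hcyc hr1 hr hx₀ hχ
      (hS.I_eq_univ hγ hD hf hx₀ hχ hmax)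
    refine ⟨hZ, fun ε hε => ?_⟩
    -- Once `V` is below the minimum `a'` over the shells with inner radius `ε`, the state is within
    -- `ε` of the equilibrium.
    obtain ⟨a', ha', haV'⟩ := hlow (fun _ => ε) fun _ => hε
    obtain ⟨N, hN⟩ := eventually_atTop.1 (hlim.eventually_lt_const ha')
    refine ⟨N, fun i hi => ?_⟩
    rw [← dist_eq_norm]
    by_contra h
    exact absurd (haV' _ _ (hmem i).1 (not_le.1 h).le (hmem i).2.1.le)
      (not_le.2 (hN i (le_of_lt hi)))
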